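/- Let $g:\mathbb{R}^2\to\mathbb{R}^2$ be Debreu's vector field $$g(x_1,x_2)=\begin{cases}\left(\frac{x_2^2}{\sqrt{1+x_2^4}},\frac{1}{\sqrt{1+x_2^4}}\right) & \text{if } x_2\ge 0,\\ (0,1) & \text{if } x_2<0.\end{cases}$$ A function $u:V\to\mathbb{R}$ is called a normal solution to the total differential equation $\nabla u=\lambda g$ around the origin if: $V\subset\mathbb{R}^2$ is open and contains the origin; $u$ is locally Lipschitz (Lipschitz on every compact subset of $V$); every level set $\{x\in V: u(x)=c\}$ is a one-dimensional $C^1$ submanifold of $\mathbb{R}^2$ (possibly empty); $g$ is orthogonal to the tangent space of every level set at each of its points; $u$ has no local maximum point and no local minimum point in $V$; and $\nabla u(x)\neq 0$ at every $x\in V$ at which $u$ is differentiable. Then $g$ is $C^1$ and vanishes nowhere, and the following hold. 1. There is an open neighborhood $V$ of the origin, with $x_1x_2\ne 1$ for all $x\in V$ with $x_2\ge 0$, on which the function $$u(x_1,x_2)=\begin{cases}\frac{x_2}{1-x_1x_2} & \text{if } x_2\ge 0,\\ x_2 & \text{if } x_2<0\end{cases}$$ is of class $C^1$ and is a normal solution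 to $\nabla u=\lambda g$ around the origin. 2. There is no normal solution $v:V\to\mathbb{R}$ to $\nabla v=\lambda g$ around the origin, on any open neighborhood $V$ of the origin, such that $v$ is of class $C^2$ on $V$. -/

import Mathlib

namespace TotalDiffEq

open Set Metric

/-- A map `f : X → ℝᴹ` on an arbitrary set `X ⊆ ℝᴺ` is of class `C^k`: around every point of `X`
it agrees on `X` with a `C^k` map defined on a ball. -/
def IsCkOn {N M : ℕ} (k : WithTop ℕ∞) (X : Set (EuclideanSpace ℝ (Fin N)))
    (f : EuclideanSpace ℝ (Fin N) → EuclideanSpace ℝ (Fin M)) : Prop :=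
  ∀ x ∈ X, ∃ r : ℝ, 0 < r ∧ ∃ F : EuclideanSpace ℝ (Fin N) → EuclideanSpace ℝ (Fin M),
    ContDiffOn ℝ k F (ball x r) ∧ ∀ y ∈ X ∩ ball x r, F y = f y

/-- `f` restricts to a `C^k` diffeomorphism from the set `X` onto the set `Y`: a bijection which is
`C^k` together with its inverse `f'`. -/
def IsCkDiffeo {N M : ℕ} (k : WithTop ℕ∞) (X : Set (EuclideanSpace ℝ (Fin N)))
    (Y : Set (EuclideanSpace ℝ (Fin M)))
    (f : EuclideanSpace ℝ (Fin N) → EuclideanSpace ℝ (Fin M)) : Prop :=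
  BijOn f X Y ∧ IsCkOn k X f ∧
    ∃ f' : EuclideanSpace ℝ (Fin M) → EuclideanSpace ℝ (Fin N),
      (∀ x ∈ X, f' (f x) = x) ∧ IsCkOn k Y f'

/-- `φ : O → φ(O)` is a `C^k` local parametrization of `X ⊆ ℝᴺ` around `x`, by an open set `O`
of `ℝᵈ`. -/
structure IsLocalParametrization {d N : ℕ} (k : WithTop ℕ∞)
    (X : Set (EuclideanSpace ℝ (Fin N))) (x : EuclideanSpace ℝ (Fin N))
    (O : Set (EuclideanSpace ℝ (Fin d)))
    (φ : EuclideanSpace ℝ (Fin d) → EuclideanSpace ℝ (Fin N)) : Prop where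
  isOpen_source : IsOpen O
  mem_image : x ∈ φ '' O
  /-- the image is relatively open in `X` -/
  image_eq : ∃ W : Set (EuclideanSpace ℝ (Fin N)), IsOpen W ∧ φ '' O = X ∩ W
  diffeo : IsCkDiffeo k O (φ '' O) φ

/-- `X ⊆ ℝᴺ` is a `d`-dimensional `C^k` manifold (a regular submanifold of `ℝᴺ`). -/
def IsCkManifold {N : ℕ} (d : ℕ) (k : WithTop ℕ∞) (X : Set (EuclideanSpace ℝ (Fin N))) : Prop :=
  ∀ x ∈ X, ∃ (O : Set (EuclideanSpace ℝ (Fin d)))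
    (φ : EuclideanSpace ℝ (Fin d) → EuclideanSpace ℝ (Fin N)), IsLocalParametrization k X x O φ

/-- The tangent space at `x` of a `d`-dimensional `C¹` manifold `X ⊆ ℝᴺ`: the range of `Dφ(p)`,
for a `C¹` local parametrization `φ` with `φ(p) = x` (all of them have the same range). -/
def tangentSpaceAt {N : ℕ} (d : ℕ) (X : Set (EuclideanSpace ℝ (Fin N)))
    (x : EuclideanSpace ℝ (Fin N)) : Set (EuclideanSpace ℝ (Fin N)) :=
  {v | ∃ (O : Set (EuclideanSpace ℝ (Fin d)))
    (φ : EuclideanSpace ℝ (Fin d) → EuclideanSpace ℝ (Fin N)),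
    IsLocalParametrization 1 X x O φ ∧ ∃ p ∈ O, φ p = x ∧ v ∈ range (fderiv ℝ φ p)}

/-- `g` is a normal vector field of the `d`-dimensional `C¹` manifold `X ⊆ ℝᴺ`. -/
def IsNormalField {N : ℕ} (d : ℕ) (X : Set (EuclideanSpace ℝ (Fin N)))
    (g : EuclideanSpace ℝ (Fin N) → EuclideanSpace ℝ (Fin N)) : Prop :=
  ∀ x ∈ X, ∀ v ∈ tangentSpaceAt d X x, inner ℝ (g x) v = 0

/-- The level set at height `c` of a function `u` with domain `V`. -/
def levelSet {n : ℕ} (V : Set (EuclideanSpace ℝ (Fin n))) (u : EuclideanSpace ℝ (Fin n) → ℝ)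
    (c : ℝ) : Set (EuclideanSpace ℝ (Fin n)) :=
  {x | x ∈ V ∧ u x = c}

/-- `u`, with domain `V ⊆ U`, is a normal solution of the total differential equation
`∇u = λ g`, where `g` is a vector field on the open set `U ⊆ ℝⁿ`. -/
structure IsNormalSolution {n : ℕ} (U : Set (EuclideanSpace ℝ (Fin n)))
    (g : EuclideanSpace ℝ (Fin n) → EuclideanSpace ℝ (Fin n))
    (V : Set (EuclideanSpace ℝ (Fin n))) (u : EuclideanSpace ℝ (Fin n) → ℝ) : Prop where
  isOpen_domain : IsOpen V
  domain_subset : V ⊆ U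
  /-- `u` is locally Lipschitz: Lipschitz on every compact subset of its domain -/
  locallyLipschitz : ∀ K ⊆ V, IsCompact K → ∃ L : NNReal, LipschitzOnWith L u K
  levelSet_manifold : ∀ c : ℝ, IsCkManifold (n - 1) 1 (levelSet V u c)
  levelSet_normal : ∀ c : ℝ, IsNormalField (n - 1) (levelSet V u c) g
  not_localMax : ∀ x ∈ V, ¬ IsLocalMaxOn u V x
  not_localMin : ∀ x ∈ V, ¬ IsLocalMinOn u V x
  gradient_ne_zero : ∀ x ∈ V, DifferentiableAt ℝ u x → gradient u x ≠ 0

/-- Debreu's vector field on `ℝ²`; the coordinates `x₁, x₂` are `x 0, x 1`. -/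
noncomputable def debreuField (x : EuclideanSpace ℝ (Fin 2)) : EuclideanSpace ℝ (Fin 2) :=
  if 0 ≤ x 1 then !₂[x 1 ^ 2 / √(1 + x 1 ^ 4), 1 / √(1 + x 1 ^ 4)] else !₂[0, 1]

/-- The function `x₂ / (1 - x₁ x₂)` for `x₂ ≥ 0`, `x₂` for `x₂ < 0` (it is only used near the
origin, where the denominator does not vanish). -/
noncomputable def debreuSolution (x : EuclideanSpace ℝ (Fin 2)) : ℝ :=
  if 0 ≤ x 1 then x 1 / (1 - x 0 * x 1) else x 1

end TotalDiffEq

namespace TotalDiffEq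

open Set Metric Filter Topology

/-- The `C¹` function equal to `t²` for `t ≥ 0` and to `0` for `t ≤ 0`. -/
noncomputable def posSq (t : ℝ) : ℝ := max t 0 ^ 2

theorem posSq_of_nonneg {t : ℝ} (ht : 0 ≤ t) : posSq t = t ^ 2 := by
  rw [posSq, max_eq_left ht]

theorem posSq_of_nonpos {t : ℝ} (ht : t ≤ 0) : posSq t = 0 := by
  rw [posSq, max_eq_right ht]; simp

theorem hasDerivAt_posSq (t : ℝ) : HasDerivAt posSq (2 * max t 0) t := by
  have hsq : HasDerivAt (fun s : ℝ => s ^ 2) (2 * t) t := by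
    simpa using hasDerivAt_pow 2 t
  rcases lt_trichotomy t 0 with ht | rfl | ht
  · rw [max_eq_right ht.le, mul_zero]
    refine (hasDerivAt_const t (0 : ℝ)).congr_of_eventuallyEq ?_
    filter_upwards [Iio_mem_nhds ht] with s hs using posSq_of_nonpos (le_of_lt hs)
  · rw [max_self, ← hasDerivWithinAt_univ, ← Iic_union_Ici (a := (0 : ℝ))]
    refine HasDerivWithinAt.union ?_ ?_
    · rw [mul_zero]
      exact (hasDerivWithinAt_const 0 _ (0 : ℝ)).congr (fun s hs => posSq_of_nonpos hs)
        (posSq_of_nonpos le_rfl)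
    · exact hsq.hasDerivWithinAt.congr (fun s hs => posSq_of_nonneg hs) (posSq_of_nonneg le_rfl)
  · rw [max_eq_left ht.le]
    refine hsq.congr_of_eventuallyEq ?_
    filter_upwards [Ioi_mem_nhds ht] with s hs using posSq_of_nonneg (le_of_lt hs)

theorem contDiff_posSq : ContDiff ℝ 1 posSq := by
  refine contDiff_one_iff_deriv.2 ⟨fun t => (hasDerivAt_posSq t).differentiableAt, ?_⟩
  rw [show deriv posSq = fun t => 2 * max t 0 from funext fun t => (hasDerivAt_posSq t).deriv]
  fun_prop

theorem debreuField_eq (x : EuclideanSpace ℝ (Fin 2)) :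
    debreuField x =
      !₂[posSq (x 1) / √(1 + posSq (x 1) ^ 2), 1 / √(1 + posSq (x 1) ^ 2)] := by
  rw [debreuField]
  split_ifs with h
  · rw [posSq_of_nonneg h, ← pow_mul]
  · rw [posSq_of_nonpos (not_le.1 h).le]; simp

theorem contDiff_coord {n : ℕ} (i : Fin n) (k : WithTop ℕ∞) :
    ContDiff ℝ k (fun x : EuclideanSpace ℝ (Fin n) => x i) :=
  contDiff_euclidean.1 contDiff_id i

theorem contDiff_debreuField : ContDiff ℝ 1 debreuField := by
  have hq : ContDiff ℝ 1 (fun x : EuclideanSpace ℝ (Fin 2) => posSq (x 1)) :=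
    contDiff_posSq.comp (contDiff_coord 1 1)
  have hs : ContDiff ℝ 1 (fun x : EuclideanSpace ℝ (Fin 2) => √(1 + posSq (x 1) ^ 2)) :=
    (contDiff_const.add (hq.pow 2)).sqrt fun x => by positivity
  rw [show debreuField = _ from funext debreuField_eq, contDiff_euclidean]
  intro i
  fin_cases i
  · exact hq.div hs fun x => by positivity
  · exact (contDiff_const (c := (1 : ℝ))).div hs fun x => by positivity

theorem debreuField_ne_zero (x : EuclideanSpace ℝ (Fin 2)) : debreuField x ≠ 0 := by
  intro h
  have h1 : debreuField x 1 = 0 := by rw [h]; rfl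
  rw [debreuField_eq] at h1
  have : 0 < 1 / √(1 + posSq (x 1) ^ 2) := by positivity
  exact this.ne' h1

theorem inner_debreuField (x w : EuclideanSpace ℝ (Fin 2)) :
    inner ℝ (debreuField x) w = (posSq (x 1) * w 0 + w 1) / √(1 + posSq (x 1) ^ 2) := by
  rw [debreuField_eq]
  simp [PiLp.inner_apply, Fin.sum_univ_two]
  ring

theorem inner_debreuField_eq_zero_iff {x w : EuclideanSpace ℝ (Fin 2)} :
    inner ℝ (debreuField x) w = 0 ↔ posSq (x 1) * w 0 + w 1 = 0 := by
  rw [inner_debreuField, div_eq_zero_iff]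
  exact or_iff_left (by positivity)

theorem mul_lt_one_of_mem_ball {x : EuclideanSpace ℝ (Fin 2)}
    (hx : x ∈ ball (0 : EuclideanSpace ℝ (Fin 2)) 1) : x 0 * x 1 < 1 := by
  rw [mem_ball_zero_iff] at hx
  have h := EuclideanSpace.norm_sq_eq x
  simp only [Fin.sum_univ_two, Real.norm_eq_abs, sq_abs] at h
  nlinarith [sq_nonneg (x 0 - x 1), norm_nonneg x]

theorem debreuSolution_eq {x : EuclideanSpace ℝ (Fin 2)} (hx : x 0 * x 1 < 1) :
    debreuSolution x = x 1 + x 0 * posSq (x 1) / (1 - x 0 * x 1) := by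
  have h : 1 - x 0 * x 1 ≠ 0 := by linarith
  rw [debreuSolution]
  split_ifs with h1
  · rw [posSq_of_nonneg h1, div_eq_iff h, add_mul, div_mul_cancel₀ _ h]; ring
  · rw [posSq_of_nonpos (not_le.1 h1).le]; simp

theorem contDiffOn_debreuSolution :
    ContDiffOn ℝ 1 debreuSolution (ball (0 : EuclideanSpace ℝ (Fin 2)) 1) := by
  refine ContDiffOn.congr (f := fun x : EuclideanSpace ℝ (Fin 2) =>
    x 1 + x 0 * posSq (x 1) / (1 - x 0 * x 1)) ?_
    fun x hx => debreuSolution_eq (mul_lt_one_of_mem_ball hx)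
  have h0 := contDiff_coord (n := 2) 0 1
  have h1 := contDiff_coord (n := 2) 1 1
  refine h1.contDiffOn.add (ContDiffOn.div (h0.mul (contDiff_posSq.comp h1)).contDiffOn
    (contDiff_const.sub (h0.mul h1)).contDiffOn fun x hx => ?_)
  have := mul_lt_one_of_mem_ball hx
  linarith

theorem hasFDerivAt_coord {n : ℕ} (i : Fin n) (x : EuclideanSpace ℝ (Fin n)) :
    HasFDerivAt (fun x : EuclideanSpace ℝ (Fin n) => x i)
      (EuclideanSpace.proj i : EuclideanSpace ℝ (Fin n) →L[ℝ] ℝ) x :=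
  (EuclideanSpace.proj i : EuclideanSpace ℝ (Fin n) →L[ℝ] ℝ).hasFDerivAt

theorem exists_fderiv_debreuSolution_eq {x : EuclideanSpace ℝ (Fin 2)}
    (hx : x ∈ ball (0 : EuclideanSpace ℝ (Fin 2)) 1) :
    ∃ k : ℝ, k ≠ 0 ∧
      ∀ w, fderiv ℝ debreuSolution x w = k * (posSq (x 1) * w 0 + w 1) := by
  have hlt := mul_lt_one_of_mem_ball hx
  have hd : 1 - x 0 * x 1 ≠ 0 := by linarith
  have h0 := hasFDerivAt_coord (n := 2) 0 x
  have h1 := hasFDerivAt_coord (n := 2) 1 x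
  have hq := (hasDerivAt_posSq (x 1)).comp_hasFDerivAt x h1
  have hu := h1.add ((h0.mul hq).mul
    ((hasDerivAt_inv hd).comp_hasFDerivAt x ((hasFDerivAt_const (1 : ℝ) x).sub (h0.mul h1))))
  have heq : debreuSolution =ᶠ[𝓝 x] fun x : EuclideanSpace ℝ (Fin 2) =>
      x 1 + x 0 * posSq (x 1) * (1 - x 0 * x 1)⁻¹ := by
    filter_upwards [isOpen_ball.mem_nhds hx] with y hy
    rw [debreuSolution_eq (mul_lt_one_of_mem_ball hy), div_eq_mul_inv]
  have hf := (hu.congr_of_eventuallyEq heq).fderiv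
  rcases le_total 0 (x 1) with h | h
  · refine ⟨1 / (1 - x 0 * x 1) ^ 2, by positivity, fun w => ?_⟩
    rw [hf]
    simp [posSq_of_nonneg h, max_eq_left h]
    field_simp
    ring
  · refine ⟨1, one_ne_zero, fun w => ?_⟩
    rw [hf]
    simp [posSq_of_nonpos h, max_eq_right h]

theorem fderiv_debreuSolution_ne_zero {x : EuclideanSpace ℝ (Fin 2)}
    (hx : x ∈ ball (0 : EuclideanSpace ℝ (Fin 2)) 1) : fderiv ℝ debreuSolution x ≠ 0 := by
  obtain ⟨k, hk, h⟩ := exists_fderiv_debreuSolution_eq hx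
  intro h0
  have := h !₂[0, 1]
  simp [h0] at this
  exact hk this.symm

theorem IsCkOn.contDiffAt {N M : ℕ} {k : WithTop ℕ∞} {X : Set (EuclideanSpace ℝ (Fin N))}
    {f : EuclideanSpace ℝ (Fin N) → EuclideanSpace ℝ (Fin M)} (hf : IsCkOn k X f)
    (hX : IsOpen X) {x : EuclideanSpace ℝ (Fin N)} (hx : x ∈ X) : ContDiffAt ℝ k f x := by
  obtain ⟨r, hr, F, hF, hFf⟩ := hf x hx
  refine (hF.contDiffAt (ball_mem_nhds x hr)).congr_of_eventuallyEq ?_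
  filter_upwards [hX.mem_nhds hx, ball_mem_nhds x hr] with y hy hy' using (hFf y ⟨hy, hy'⟩).symm

theorem _root_.ContDiffOn.isCkOn {N M : ℕ} {k : WithTop ℕ∞}
    {O X : Set (EuclideanSpace ℝ (Fin N))}
    {f : EuclideanSpace ℝ (Fin N) → EuclideanSpace ℝ (Fin M)} (hf : ContDiffOn ℝ k f O)
    (hO : IsOpen O) (hX : X ⊆ O) : IsCkOn k X f := by
  intro x hx
  obtain ⟨r, hr, h⟩ := Metric.isOpen_iff.1 hO x (hX hx)
  exact ⟨r, hr, f, hf.mono h, fun _ _ => rfl⟩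

/-- The derivative of a function vanishes on the tangent spaces of its level sets. -/
theorem fderiv_eq_zero_of_mem_tangentSpaceAt {n d : ℕ} {V : Set (EuclideanSpace ℝ (Fin n))}
    {u : EuclideanSpace ℝ (Fin n) → ℝ} {c : ℝ} {x w : EuclideanSpace ℝ (Fin n)}
    (hu : DifferentiableAt ℝ u x) (hw : w ∈ tangentSpaceAt d (levelSet V u c) x) :
    fderiv ℝ u x w = 0 := by
  obtain ⟨O, φ, hφ, p, hp, rfl, y, rfl⟩ := hw
  have hφp : DifferentiableAt ℝ φ p :=
    (hφ.diffeo.2.1.contDiffAt hφ.isOpen_source hp).differentiableAt one_ne_zero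
  have hc : u ∘ φ =ᶠ[𝓝 p] fun _ => c := by
    obtain ⟨W, -, hW⟩ := hφ.image_eq
    filter_upwards [hφ.isOpen_source.mem_nhds hp] with q hq
    have : φ q ∈ levelSet V u c ∩ W := hW ▸ mem_image_of_mem φ hq
    exact this.1.2
  have h := fderiv_comp p hu hφp
  rw [hc.fderiv_eq] at h
  have := congrArg (fun A => A y) h
  simpa using this.symm

/-- The part in an open set `V` of the graph of a `C¹` function `h`, defined on an open set of the
line, is a `C¹` manifold. -/
theorem isCkManifold_graph {V : Set (EuclideanSpace ℝ (Fin 2))} (hV : IsOpen V) {h : ℝ → ℝ}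
    {S : Set ℝ} (hS : IsOpen S) (hh : ContDiffOn ℝ 1 h S) :
    IsCkManifold 1 1 {x : EuclideanSpace ℝ (Fin 2) | x ∈ V ∧ x 0 ∈ S ∧ x 1 = h (x 0)} := by
  intro x hx
  set X := {x : EuclideanSpace ℝ (Fin 2) | x ∈ V ∧ x 0 ∈ S ∧ x 1 = h (x 0)}
  set φ : EuclideanSpace ℝ (Fin 1) → EuclideanSpace ℝ (Fin 2) := fun p => !₂[p 0, h (p 0)]
  set ψ : EuclideanSpace ℝ (Fin 2) → EuclideanSpace ℝ (Fin 1) := fun x => !₂[x 0]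
  set O₁ : Set (EuclideanSpace ℝ (Fin 1)) := {p | p 0 ∈ S}
  have hO₁ : IsOpen O₁ := hS.preimage (contDiff_coord (n := 1) 0 0).continuous
  have hφ : ContDiffOn ℝ 1 φ O₁ := by
    rw [contDiffOn_euclidean]
    intro i
    fin_cases i
    · exact (contDiff_coord (n := 1) 0 1).contDiffOn
    · exact hh.comp (contDiff_coord (n := 1) 0 1).contDiffOn fun p hp => hp
  have hψ : ContDiff ℝ 1 ψ := by
    rw [contDiff_euclidean]
    intro i
    fin_cases i
    exact contDiff_coord (n := 2) 0 1
  have hO : IsOpen (O₁ ∩ φ ⁻¹' V) := hφ.continuousOn.isOpen_inter_preimage hO₁ hV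
  have hψφ : ∀ p, ψ (φ p) = p := fun p => by ext i; fin_cases i; rfl
  have hφψ : ∀ y ∈ X, φ (ψ y) = y := fun y hy => by
    ext i
    fin_cases i
    · rfl
    · exact hy.2.2.symm
  have himage : φ '' (O₁ ∩ φ ⁻¹' V) = X := by
    ext y
    constructor
    · rintro ⟨p, ⟨hp, hpV⟩, rfl⟩
      exact ⟨hpV, hp, rfl⟩
    · intro hy
      exact ⟨ψ y, ⟨hy.2.1, by rw [mem_preimage, hφψ y hy]; exact hy.1⟩, hφψ y hy⟩
  refine ⟨O₁ ∩ φ ⁻¹' V, φ, hO, himage ▸ hx, ⟨univ, isOpen_univ, by rw [himage, inter_univ]⟩, ?_⟩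
  exact ⟨InjOn.bijOn_image fun p _ q _ hpq => by rw [← hψφ p, hpq, hψφ],
    hφ.isCkOn hO₁ inter_subset_left, ψ, fun p _ => hψφ p,
    hψ.contDiffOn.isCkOn isOpen_univ (subset_univ _)⟩

theorem levelSet_debreuSolution (c : ℝ) :
    levelSet (ball 0 1) debreuSolution c =
      {x : EuclideanSpace ℝ (Fin 2) | x ∈ ball 0 1 ∧ x 0 ∈ {t | 0 < 1 + max c 0 * t} ∧
        x 1 = c / (1 + max c 0 * x 0)} := by
  ext x
  refine and_congr_right fun hx => ?_
  have hlt := mul_lt_one_of_mem_ball hx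
  have hd : 0 < 1 - x 0 * x 1 := by linarith
  simp only [mem_ofPred_eq]
  rw [debreuSolution]
  split_ifs with h
  · constructor
    · intro hc
      have hc0 : 0 ≤ c := hc ▸ div_nonneg h hd.le
      rw [max_eq_left hc0]
      have : 1 + c * x 0 = 1 / (1 - x 0 * x 1) := by
        rw [← hc, eq_div_iff hd.ne', add_mul, mul_right_comm, div_mul_cancel₀ _ hd.ne']; ring
      rw [this]
      refine ⟨by positivity, ?_⟩
      rw [← hc, one_div, div_inv_eq_mul, div_mul_cancel₀ _ hd.ne']
    · rintro ⟨hp, hc⟩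
      have hc0 : 0 ≤ c := by
        by_contra hcn
        have := div_neg_of_neg_of_pos (not_le.1 hcn) hp
        linarith
      rw [max_eq_left hc0] at hp hc
      rw [eq_div_iff hp.ne'] at hc
      rw [div_eq_iff hd.ne']
      linarith
  · have h := not_le.1 h
    constructor
    · rintro rfl
      rw [max_eq_right h.le]; simp
    · rintro ⟨hp, hc⟩
      have hc0 : c ≤ 0 := by
        by_contra hcn
        have := div_pos (not_le.1 hcn) hp
        linarith
      rw [hc, max_eq_right hc0]; simp

theorem isNormalSolution_debreuSolution :
    IsNormalSolution univ debreuField (ball 0 1) debreuSolution where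
  isOpen_domain := isOpen_ball
  domain_subset := subset_univ _
  locallyLipschitz K hK hc :=
    ((contDiffOn_debreuSolution.locallyLipschitzOn (convex_ball 0 1)).mono
      hK).exists_lipschitzOnWith_of_compact hc
  levelSet_manifold c := by
    rw [levelSet_debreuSolution]
    refine isCkManifold_graph isOpen_ball (isOpen_lt continuous_const (by fun_prop))
      (h := fun t => c / (1 + max c 0 * t)) ?_
    refine ContDiffOn.div contDiffOn_const (by fun_prop) fun t ht => ?_
    exact ne_of_gt ht
  levelSet_normal c x hx w hw := by
    obtain ⟨k, hk, h⟩ := exists_fderiv_debreuSolution_eq hx.1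
    have h0 := fderiv_eq_zero_of_mem_tangentSpaceAt
      ((contDiffOn_debreuSolution.contDiffAt (isOpen_ball.mem_nhds hx.1)).differentiableAt
        one_ne_zero) hw
    rw [h w] at h0
    exact inner_debreuField_eq_zero_iff.2 ((mul_eq_zero.1 h0).resolve_left hk)
  not_localMax x hx h := fderiv_debreuSolution_ne_zero hx
    (h.isLocalMax (isOpen_ball.mem_nhds hx)).fderiv_eq_zero
  not_localMin x hx h := fderiv_debreuSolution_ne_zero hx
    (h.isLocalMin (isOpen_ball.mem_nhds hx)).fderiv_eq_zero
  gradient_ne_zero x hx _ := by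
    rw [gradient, Ne, LinearIsometryEquiv.map_eq_zero_iff]
    exact fderiv_debreuSolution_ne_zero hx

/-- The tangent space of a `C¹` curve contains a nonzero vector. -/
theorem IsCkManifold.exists_mem_tangentSpaceAt_ne_zero {N : ℕ}
    {X : Set (EuclideanSpace ℝ (Fin N))} (hX : IsCkManifold 1 1 X)
    {x : EuclideanSpace ℝ (Fin N)} (hx : x ∈ X) : ∃ w ∈ tangentSpaceAt 1 X x, w ≠ 0 := by
  obtain ⟨O, φ, hφ⟩ := hX x hx
  obtain ⟨p, hp, rfl⟩ := hφ.mem_image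
  refine ⟨fderiv ℝ φ p (EuclideanSpace.single 0 1), ⟨O, φ, hφ, p, hp, rfl, mem_range_self _⟩, ?_⟩
  have hφp : DifferentiableAt ℝ φ p :=
    (hφ.diffeo.2.1.contDiffAt hφ.isOpen_source hp).differentiableAt one_ne_zero
  obtain ⟨ψ, hψφ, hψ⟩ := hφ.diffeo.2.2
  obtain ⟨r, hr, F, hF, hFψ⟩ := hψ (φ p) (mem_image_of_mem φ hp)
  have hFd : DifferentiableAt ℝ F (φ p) :=
    (hF.contDiffAt (ball_mem_nhds _ hr)).differentiableAt one_ne_zero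
  have hid : F ∘ φ =ᶠ[𝓝 p] id := by
    filter_upwards [hφ.isOpen_source.mem_nhds hp,
      hφp.continuousAt.preimage_mem_nhds (ball_mem_nhds _ hr)] with q hq hqr
    rw [Function.comp_apply, hFψ _ ⟨mem_image_of_mem φ hq, hqr⟩, hψφ q hq, id]
  have h := fderiv_comp p hFd hφp
  rw [hid.fderiv_eq, fderiv_id] at h
  intro h0
  have := congrArg (fun A => A (EuclideanSpace.single 0 1)) h
  simp [h0] at this

theorem clm_apply_eq_sum (A : EuclideanSpace ℝ (Fin 2) →L[ℝ] ℝ) (w : EuclideanSpace ℝ (Fin 2)) :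
    A w = w 0 * A (EuclideanSpace.single 0 1) + w 1 * A (EuclideanSpace.single 1 1) := by
  have : w = w 0 • EuclideanSpace.single 0 1 + w 1 • EuclideanSpace.single 1 1 := by
    ext i; fin_cases i <;> simp
  conv_lhs => rw [this]
  simp

section

variable {V : Set (EuclideanSpace ℝ (Fin 2))} {v : EuclideanSpace ℝ (Fin 2) → ℝ}

theorem IsNormalSolution.fderiv_single_eq (hv : IsNormalSolution univ debreuField V v)
    {x : EuclideanSpace ℝ (Fin 2)} (hx : x ∈ V) (hd : DifferentiableAt ℝ v x) :
    fderiv ℝ v x (EuclideanSpace.single 0 1) =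
      posSq (x 1) * fderiv ℝ v x (EuclideanSpace.single 1 1) := by
  obtain ⟨w, hw, hw0⟩ := IsCkManifold.exists_mem_tangentSpaceAt_ne_zero
    (hv.levelSet_manifold (v x)) (x := x) ⟨hx, rfl⟩
  have h1 := fderiv_eq_zero_of_mem_tangentSpaceAt hd hw
  have h2 := inner_debreuField_eq_zero_iff.1 (hv.levelSet_normal (v x) x ⟨hx, rfl⟩ w hw)
  have hw1 : w 1 = -(posSq (x 1) * w 0) := by linarith
  rw [clm_apply_eq_sum, hw1] at h1
  have hw00 : w 0 ≠ 0 := by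
    intro h0
    refine hw0 ?_
    ext i
    fin_cases i
    · exact h0
    · simp [hw1, h0]
  refine mul_left_cancel₀ hw00 ?_
  linarith

theorem IsNormalSolution.fderiv_single_ne_zero (hv : IsNormalSolution univ debreuField V v)
    {x : EuclideanSpace ℝ (Fin 2)} (hx : x ∈ V) (hd : DifferentiableAt ℝ v x) :
    fderiv ℝ v x (EuclideanSpace.single 1 1) ≠ 0 := by
  intro h
  refine hv.gradient_ne_zero x hx hd ?_
  rw [gradient, LinearIsometryEquiv.map_eq_zero_iff]
  ext w
  rw [clm_apply_eq_sum, hv.fderiv_single_eq hx hd, h]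
  simp

/-- Symmetry of the second derivative gives a first order equation for `∂₂v`. -/
theorem IsNormalSolution.fderiv_fderiv_single_eq (hv : IsNormalSolution univ debreuField V v)
    (hc : ContDiffOn ℝ 2 v V) {x : EuclideanSpace ℝ (Fin 2)} (hx : x ∈ V) :
    fderiv ℝ (fun y => fderiv ℝ v y (EuclideanSpace.single 1 1)) x (EuclideanSpace.single 0 1) =
      2 * max (x 1) 0 * fderiv ℝ v x (EuclideanSpace.single 1 1) + posSq (x 1) *
        fderiv ℝ (fun y => fderiv ℝ v y (EuclideanSpace.single 1 1)) x
          (EuclideanSpace.single 1 1) := by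
  set e₀ : EuclideanSpace ℝ (Fin 2) := EuclideanSpace.single 0 1
  set e₁ : EuclideanSpace ℝ (Fin 2) := EuclideanSpace.single 1 1
  have hV := hv.isOpen_domain
  have hD : DifferentiableAt ℝ (fderiv ℝ v) x :=
    ((hc.fderiv_of_isOpen (m := 1) hV (by norm_num)).contDiffAt
      (hV.mem_nhds hx)).differentiableAt one_ne_zero
  have happ (e) : HasFDerivAt (fun y => fderiv ℝ v y e)
      ((fderiv ℝ (fderiv ℝ v) x).flip e) x := by
    simpa using hD.hasFDerivAt.clm_apply (hasFDerivAt_const e x)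
  have heq : (fun y => fderiv ℝ v y e₀) =ᶠ[𝓝 x] fun y => posSq (y 1) * fderiv ℝ v y e₁ := by
    filter_upwards [hV.mem_nhds hx] with y hy
    exact hv.fderiv_single_eq hy ((hc.contDiffAt (hV.mem_nhds hy)).differentiableAt two_ne_zero)
  have hmul := ((hasDerivAt_posSq (x 1)).comp_hasFDerivAt x (hasFDerivAt_coord 1 x)).mul (happ e₁)
  have h := congrArg (fun A => A e₁)
    ((happ e₀).unique (hmul.congr_of_eventuallyEq heq))
  have hsymm : fderiv ℝ (fderiv ℝ v) x e₀ e₁ = fderiv ℝ (fderiv ℝ v) x e₁ e₀ :=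
    ((hc.contDiffAt (hV.mem_nhds hx)).isSymmSndFDerivAt (by simp)).eq e₀ e₁
  rw [(happ e₁).fderiv]
  simp only [ContinuousLinearMap.flip_apply, hsymm]
  simp [e₁] at h ⊢
  linarith

theorem not_isNormalSolution_of_contDiffOn_two (h0 : (0 : EuclideanSpace ℝ (Fin 2)) ∈ V)
    (hc : ContDiffOn ℝ 2 v V) : ¬ IsNormalSolution univ debreuField V v := by
  intro hv
  have hV := hv.isOpen_domain
  set e₀ : EuclideanSpace ℝ (Fin 2) := EuclideanSpace.single 0 1 with he₀
  set e₁ : EuclideanSpace ℝ (Fin 2) := EuclideanSpace.single 1 1 with he₁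
  set w : EuclideanSpace ℝ (Fin 2) → ℝ := fun y => fderiv ℝ v y e₁ with hw
  have hwc : ContDiffOn ℝ 1 w V :=
    (hc.fderiv_of_isOpen (m := 1) hV (by norm_num)).clm_apply contDiffOn_const
  have hwd : ∀ x ∈ V, DifferentiableAt ℝ w x := fun x hx =>
    (hwc.contDiffAt (hV.mem_nhds hx)).differentiableAt one_ne_zero
  have hw0 : w 0 ≠ 0 := hv.fderiv_single_ne_zero h0
    ((hc.contDiffAt (hV.mem_nhds h0)).differentiableAt two_ne_zero)
  have hwe : ∀ x ∈ V, fderiv ℝ w x e₀ =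
      2 * max (x 1) 0 * w x + posSq (x 1) * fderiv ℝ w x e₁ := fun x hx =>
    hv.fderiv_fderiv_single_eq hc hx
  -- near the origin, `∂₁w` is bounded below by a multiple of `x₂`
  have hcont : ContinuousAt (fun x => w 0 * (2 * w x + max (x 1) 0 * fderiv ℝ w x e₁)) 0 := by
    have h1 : ContinuousAt w 0 := (hwd 0 h0).continuousAt
    have h2 : ContinuousAt (fderiv ℝ w) 0 :=
      (hwc.continuousOn_fderiv_of_isOpen hV le_rfl).continuousAt (hV.mem_nhds h0)
    have h3 : Continuous fun x : EuclideanSpace ℝ (Fin 2) => max (x 1) 0 := by fun_prop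
    exact continuousAt_const.mul ((continuousAt_const.mul h1).add
      (h3.continuousAt.mul (h2.clm_apply continuousAt_const)))
  have hlt : ∀ᶠ x in 𝓝 (0 : EuclideanSpace ℝ (Fin 2)),
      w 0 ^ 2 < w 0 * (2 * w x + max (x 1) 0 * fderiv ℝ w x e₁) := by
    refine hcont.eventually_const_lt ?_
    have : 0 < w 0 ^ 2 := by positivity
    simp
    linarith
  obtain ⟨r, hr, hball⟩ := Metric.mem_nhds_iff.1 (hlt.and (hV.mem_nhds h0))
  obtain ⟨a, ha, har⟩ : ∃ a : ℝ, 0 < a ∧ 2 * a < r := ⟨r / 3, by positivity, by linarith⟩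
  have hmem : ∀ s t : ℝ, |s| ≤ a → |t| ≤ a → s • e₀ + t • e₁ ∈ ball 0 r := by
    intro s t hs ht
    rw [mem_ball_zero_iff]
    refine (norm_add_le _ _).trans_lt ?_
    simp only [norm_smul, he₀, he₁, PiLp.norm_single, Real.norm_eq_abs, abs_one, mul_one]
    linarith
  have hslope : ∀ t : ℝ, |t| ≤ a → ∃ m : ℝ, w 0 ^ 2 ≤ w 0 * m ∧
      w (a • e₀ + t • e₁) - w (t • e₁) = a * (max t 0 * m) := by
    intro t ht
    have hder : ∀ s ∈ Icc 0 a, HasDerivAt (fun s : ℝ => w (s • e₀ + t • e₁))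
        (fderiv ℝ w (s • e₀ + t • e₁) e₀) s := by
      intro s hs
      have hp := hmem s t (by rw [abs_of_nonneg hs.1]; exact hs.2) ht
      have hl : HasDerivAt (fun s : ℝ => s • e₀ + t • e₁) e₀ s := by
        simpa using ((hasDerivAt_id s).smul_const e₀).add_const (t • e₁)
      exact (hwd _ (hball hp).2).hasFDerivAt.comp_hasDerivAt s hl
    obtain ⟨s, hs, hsl⟩ := exists_hasDerivAt_eq_slope _ _ ha
      (fun s hs => (hder s hs).continuousAt.continuousWithinAt)
      (fun s hs => hder s (Ioo_subset_Icc_self hs))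
    have hp := hball (hmem s t (by rw [abs_of_nonneg hs.1.le]; exact hs.2.le) ht)
    refine ⟨_, hp.1.le, ?_⟩
    have hcoord : (s • e₀ + t • e₁) 1 = t := by simp [he₀, he₁]
    rw [hwe _ hp.2, sub_zero, eq_div_iff ha.ne', zero_smul, zero_add] at hsl
    rw [← hsl, hcoord, posSq]
    ring
  set Q : ℝ → ℝ := fun t => w 0 * (w (a • e₀ + t • e₁) - w (t • e₁)) with hQ
  have hnear : ∀ᶠ t in 𝓝 (0 : ℝ), |t| ≤ a := by
    filter_upwards [Metric.ball_mem_nhds (0 : ℝ) ha] with t ht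
    simpa using (mem_ball_zero_iff.1 ht).le
  have hbound : ∀ t : ℝ, |t| ≤ a → a * w 0 ^ 2 * max t 0 ≤ Q t := by
    intro t ht
    obtain ⟨m, hm, hmt⟩ := hslope t ht
    have : Q t = a * max t 0 * (w 0 * m) := by simp only [hQ, hmt]; ring
    rw [this, mul_right_comm]
    exact mul_le_mul_of_nonneg_left hm (by positivity)
  have hQ0 : Q 0 = 0 := by
    obtain ⟨m, -, hmt⟩ := hslope 0 (by simpa using ha.le)
    simp only [hQ, hmt]; simp
  have hQd : DifferentiableAt ℝ Q 0 := by
    have h1 := hwd _ (hball (hmem a 0 (abs_of_pos ha).le (by simpa using ha.le))).2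
    have h2 : DifferentiableAt ℝ w ((0 : ℝ) • e₁) := by rw [zero_smul]; exact hwd 0 h0
    exact (((h1.comp (0 : ℝ) (f := fun t : ℝ => a • e₀ + t • e₁) (by fun_prop)).sub
      (h2.comp (0 : ℝ) (f := fun t : ℝ => t • e₁) (by fun_prop))).const_mul _)
  -- `0` is a local minimum both of `Q` and of `Q` minus a nonzero linear function
  have hmin₁ : IsLocalMin Q 0 := by
    filter_upwards [hnear] with t ht
    rw [hQ0]
    exact le_trans (by positivity) (hbound t ht)
  have hmin₂ : IsLocalMin (fun t => Q t - a * w 0 ^ 2 * t) 0 := by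
    filter_upwards [hnear] with t ht
    have := mul_le_mul_of_nonneg_left (le_max_left t 0) (by positivity : 0 ≤ a * w 0 ^ 2)
    have := hbound t ht
    simp only [hQ0, mul_zero, sub_zero]
    linarith
  have hd₁ := hmin₁.hasDerivAt_eq_zero hQd.hasDerivAt
  have hd₂ := hmin₂.hasDerivAt_eq_zero
    (hQd.hasDerivAt.sub ((hasDerivAt_id (0 : ℝ)).const_mul (a * w 0 ^ 2)))
  have : 0 < a * w 0 ^ 2 := by positivity
  linarith

end

end TotalDiffEq

theorem mainTheorem6 :
    (ContDiff ℝ 1 TotalDiffEq.debreuField ∧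
      ∀ x : EuclideanSpace ℝ (Fin 2), TotalDiffEq.debreuField x ≠ 0) ∧
    (∃ V : Set (EuclideanSpace ℝ (Fin 2)), (0 : EuclideanSpace ℝ (Fin 2)) ∈ V ∧
      (∀ x ∈ V, 0 ≤ x 1 → x 0 * x 1 ≠ 1) ∧
      TotalDiffEq.IsNormalSolution Set.univ TotalDiffEq.debreuField V
        TotalDiffEq.debreuSolution ∧
      ContDiffOn ℝ 1 TotalDiffEq.debreuSolution V) ∧
    ¬ ∃ (V : Set (EuclideanSpace ℝ (Fin 2))) (v : EuclideanSpace ℝ (Fin 2) → ℝ),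
      (0 : EuclideanSpace ℝ (Fin 2)) ∈ V ∧
      TotalDiffEq.IsNormalSolution Set.univ TotalDiffEq.debreuField V v ∧
      ContDiffOn ℝ 2 v V := by
  refine ⟨⟨TotalDiffEq.contDiff_debreuField, TotalDiffEq.debreuField_ne_zero⟩,
    ⟨Metric.ball 0 1, Metric.mem_ball_self one_pos,
      fun x hx _ => (TotalDiffEq.mul_lt_one_of_mem_ball hx).ne,
      TotalDiffEq.isNormalSolution_debreuSolution, TotalDiffEq.contDiffOn_debreuSolution⟩, ?_⟩
  rintro ⟨V, v, h0, hv, hc⟩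
  exact TotalDiffEq.not_isNormalSolution_of_contDiffOn_two h0 hc hv
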